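/- Let $\omega>0$. For a real sequence $q=(q_k)_{k\in\mathbb Z}$ put $(\Delta q)_k=q_{k+1}-2q_k+q_{k-1}$ and $q^\Delta=-\Delta q$. Let $l^\Delta$ be the set of bounded real sequences $q\in l_\infty(\mathbb Z)$ such that 1. $q^\Delta\in l_2(\mathbb Z)$, so that $Q^\Delta(\lambda)=\sum_{k\in\mathbb Z}e^{ik\lambda}q^\Delta_k$ is defined as an element of $L_2([0,2\pi])$ (convergence in $L_2$), and 2. for some real number $A$ the function $$h(\lambda)=\frac1\lambda\left(\frac{Q^\Delta(\lambda)}{\lambda}-iA\right)$$ belongs to $L_1([0,\pi])$. Consider the infinite harmonic chain $$\ddot q_k(t)=\omega^2(\Delta q(t))_k,\qquad k\in\mathbb Z,\ t\ge 0,$$ with initial conditions $q(0)=q_0\in l^\Delta$ and $p(0)=\dot q(0)=0$. It has exactly one solution $q(t)$ in $l_\infty(\mathbb Z)$, that is, with $\sup_{0\le t\le T}\sup_k|q_k(t)|<\infty$ for every $T\ge 0$, and this solution is uniformly bounded: $$\sup_{t\ge0}\ \sup_{k\in\mathbb Z}|q_k(t)|<\infty .$$ -/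

import Mathlib

open scoped ENNReal

instance factTwoPiPos : Fact (0 < 2 * Real.pi) := ⟨Real.two_pi_pos⟩

/-- The discrete Laplacian of a two-sided sequence. -/
def discreteLaplacian (q : ℤ → ℝ) (k : ℤ) : ℝ :=
  q (k + 1) - 2 * q k + q (k - 1)

/-- The sequence `q^Δ = -Δ q`, i.e. `q^Δ_k = 2 q_k - q_{k+1} - q_{k-1}`. -/
def secondDiff (q : ℤ → ℝ) (k : ℤ) : ℝ :=
  2 * q k - q (k + 1) - q (k - 1)

/-- The Fourier transform `λ ↦ ∑ k, exp (i k λ) a k` of a square-summable sequence, as an element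
of `L²` of the circle `ℝ / 2πℤ` (the series converges in `L²`): on this circle Mathlib's
`fourierBasis` is the Hilbert basis made of the monomials `λ ↦ exp (i k λ)`. -/
noncomputable def fourierTransformL2 (a : lp (fun _ : ℤ => ℂ) 2) :
    MeasureTheory.Lp ℂ 2 (AddCircle.haarAddCircle (T := 2 * Real.pi)) :=
  (fourierBasis (T := 2 * Real.pi)).repr.symm a

/-- The set `l^Δ` of bounded real sequences `q` such that `q^Δ` is square-summable and, with `Q^Δ`
the Fourier transform of `q^Δ`, the function `λ ↦ (1/λ) (Q^Δ(λ)/λ - i A)` is integrable on `[0, π]`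
for some real number `A`. -/
def lDelta : Set (ℤ → ℝ) :=
  {q | Memℓp q ∞ ∧
    ∃ hq : Memℓp (fun k : ℤ => (secondDiff q k : ℂ)) 2, ∃ A : ℝ,
      MeasureTheory.IntegrableOn
        (fun x : ℝ =>
          (1 / (x : ℂ)) *
            (fourierTransformL2 ⟨fun k : ℤ => (secondDiff q k : ℂ), hq⟩
                (x : AddCircle (2 * Real.pi)) / (x : ℂ) - Complex.I * (A : ℂ)))
        (Set.Icc 0 Real.pi) MeasureTheory.volume}

/-- `q`, with velocities `p = dq/dt`, solves the infinite harmonic chain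
`d²q_k/dt² = ω² (Δ q)_k`, `t ≥ 0`, in the space of bounded sequences, with `q(0) = q₀`, `p(0) = 0`.
The last clause says that `q` takes values in `l_∞`, locally boundedly in time: it selects the
solution, as the system of scalar equations alone does not determine it. -/
structure IsChainSolution (ω : ℝ) (q₀ : ℤ → ℝ) (q p : ℝ → ℤ → ℝ) : Prop where
  init_pos : q 0 = q₀
  init_vel : p 0 = 0
  hasDeriv_pos : ∀ t : ℝ, 0 ≤ t → ∀ k : ℤ,
    HasDerivWithinAt (fun s => q s k) (p t k) (Set.Ici 0) t
  hasDeriv_vel : ∀ t : ℝ, 0 ≤ t → ∀ k : ℤ,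
    HasDerivWithinAt (fun s => p s k) (ω ^ 2 * discreteLaplacian (q t) k) (Set.Ici 0) t
  locally_bounded : ∀ T : ℝ, 0 ≤ T → ∃ C : ℝ, ∀ t ∈ Set.Icc 0 T, ∀ k : ℤ, |q t k| ≤ C

/-! Write `Q^Δ = u + i v` and `s = sin (x / 2)`. On the Fourier side `-Δ` is multiplication by `4
s²`, so the solution should be `q₀ k` plus `π⁻¹` times the integral over `[0, π]` of `(cos (2ωts) -
1) / (4 s²)` against `u cos kx + v sin kx`; half the circle suffices because the data are real. The
zero of `s` at the origin is the only obstacle to a bound uniform in `t` and `k`.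

Membership in `l^Δ` says `Q^Δ = i A x + x² h` with `h` integrable. The multiplier times `x²` is
bounded, so `h` contributes a bounded term. In the `A` term, `x / (4 s²)` may be replaced by `1 / x`
up to a bounded error, and product formulas reduce it to integrals of `sin (κ x + τ sin (x / 2)) /
x` over `[0, π]`. The crux, `abs_integral_sin_phase_le`, bounds these uniformly in `κ` and `τ`, by a
van der Corput argument that also covers a stationary point near the origin, where the phase
degenerates to third order.

Uniqueness is independent of this: `Δ` is bounded on bounded sequences, so a locally bounded
difference of two solutions is killed by iterating the equation (`chain_eq_zero`). -/

/-! ### Uniform bounds for oscillatory integrals with kernel 1/x -/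

/-- First-derivative test for oscillatory integrals with amplitude `1 / x`. -/
lemma abs_integral_sin_div_le {φ φ' φ'' : ℝ → ℝ} {α β M : ℝ} (hα : 0 < α) (hαβ : α ≤ β)
    (hM : 0 < M) (hφ : ∀ x, HasDerivAt φ (φ' x) x) (hφ' : ∀ x, HasDerivAt φ' (φ'' x) x)
    (hc : Continuous φ'') (hpos : ∀ x ∈ Set.Icc α β, 0 ≤ φ'' x)
    (hlow : ∀ x ∈ Set.Icc α β, M ≤ |φ' x|) :
    |∫ x in α..β, Real.sin (φ x) / x| ≤ 5 / (M * α) := by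
  have hu : Set.uIcc α β = Set.Icc α β := Set.uIcc_of_le hαβ
  have hx0 : ∀ x ∈ Set.Icc α β, 0 < x := fun x hx => hα.trans_le hx.1
  have hne : ∀ x ∈ Set.Icc α β, φ' x ≠ 0 := fun x hx h => by
    have := hlow x hx
    rw [h, abs_zero] at this
    linarith
  have cφ : Continuous φ := continuous_iff_continuousAt.2 fun x => (hφ x).continuousAt
  have cφ' : Continuous φ' := continuous_iff_continuousAt.2 fun x => (hφ' x).continuousAt
  -- Integration by parts: `G' = sin φ / x + K`, and `|K| ≤ B = H'`. As `φ'' ≥ 0`, the term `φ'' /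
  -- φ'²` is nonnegative and is the exact derivative of `-1 / φ'`, so no bound on `φ''` is needed.
  -- The boundary terms of `G` cost `2 / (M α)` and the increment of `H` costs `3 / (M α)`.
  set G : ℝ → ℝ := fun x => -Real.cos (φ x) * ((φ' x)⁻¹ * x⁻¹) with hG
  set K : ℝ → ℝ := fun x =>
    Real.cos (φ x) * (φ'' x / φ' x ^ 2 * x⁻¹ + (φ' x)⁻¹ * (x ^ 2)⁻¹) with hK
  set H : ℝ → ℝ := fun x => -(α⁻¹ * (φ' x)⁻¹) - M⁻¹ * x⁻¹ with hH
  set B : ℝ → ℝ := fun x => α⁻¹ * (φ'' x / φ' x ^ 2) + M⁻¹ * (x ^ 2)⁻¹ with hB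
  have cK : ContinuousOn K (Set.uIcc α β) := by
    rw [hu]
    have h1 : ∀ x ∈ Set.Icc α β, x ≠ 0 := fun x hx => (hx0 x hx).ne'
    have h2 : ∀ x ∈ Set.Icc α β, x ^ 2 ≠ 0 := fun x hx => pow_ne_zero 2 (h1 x hx)
    have h3 : ∀ x ∈ Set.Icc α β, φ' x ^ 2 ≠ 0 := fun x hx => pow_ne_zero 2 (hne x hx)
    fun_prop (disch := assumption)
  have cB : ContinuousOn B (Set.uIcc α β) := by
    rw [hu]
    have h2 : ∀ x ∈ Set.Icc α β, x ^ 2 ≠ 0 := fun x hx => pow_ne_zero 2 (hx0 x hx).ne'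
    have h3 : ∀ x ∈ Set.Icc α β, φ' x ^ 2 ≠ 0 := fun x hx => pow_ne_zero 2 (hne x hx)
    fun_prop (disch := assumption)
  have cS : ContinuousOn (fun x => Real.sin (φ x) / x) (Set.uIcc α β) := by
    rw [hu]
    have h1 : ∀ x ∈ Set.Icc α β, x ≠ 0 := fun x hx => (hx0 x hx).ne'
    fun_prop (disch := assumption)
  have dG : ∀ x ∈ Set.uIcc α β, HasDerivAt G (Real.sin (φ x) / x + K x) x := by
    rw [hu]
    intro x hx
    have h1 := hne x hx
    have h2 := (hx0 x hx).ne'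
    have := ((hφ x).cos.neg).mul (((hφ' x).inv h1).mul (hasDerivAt_inv h2))
    refine this.congr_deriv ?_
    simp only [hK, Pi.inv_apply, Pi.neg_apply, Pi.mul_apply]
    field_simp
    ring
  have dH : ∀ x ∈ Set.uIcc α β, HasDerivAt H (B x) x := by
    rw [hu]
    intro x hx
    have h1 := hne x hx
    have h2 := (hx0 x hx).ne'
    have := ((((hφ' x).inv h1).const_mul α⁻¹).neg).sub ((hasDerivAt_inv h2).const_mul M⁻¹)
    refine this.congr_deriv ?_
    simp only [hB]
    field_simp
    ring
  have iS := cS.intervalIntegrable (μ := MeasureTheory.volume)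
  have iK := cK.intervalIntegrable (μ := MeasureTheory.volume)
  have iB := cB.intervalIntegrable (μ := MeasureTheory.volume)
  have eG := intervalIntegral.integral_eq_sub_of_hasDerivAt dG (iS.add iK)
  have eH := intervalIntegral.integral_eq_sub_of_hasDerivAt dH iB
  rw [intervalIntegral.integral_add iS iK] at eG
  have hinv : ∀ x ∈ Set.Icc α β, |(φ' x)⁻¹| ≤ M⁻¹ := fun x hx => by
    rw [abs_inv]
    exact inv_anti₀ hM (hlow x hx)
  have hxinv : ∀ x ∈ Set.Icc α β, 0 < x⁻¹ ∧ x⁻¹ ≤ α⁻¹ := fun x hx =>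
    ⟨inv_pos.2 (hx0 x hx), inv_anti₀ hα hx.1⟩
  have hKB : |∫ x in α..β, K x| ≤ H β - H α := by
    rw [← eH, ← Real.norm_eq_abs]
    refine intervalIntegral.norm_integral_le_of_norm_le hαβ ?_ iB
    refine Filter.Eventually.of_forall fun x hx => ?_
    have hx' : x ∈ Set.Icc α β := ⟨hx.1.le, hx.2⟩
    have hp : 0 ≤ φ'' x / φ' x ^ 2 := div_nonneg (hpos x hx') (sq_nonneg _)
    have hq : 0 ≤ (x ^ 2)⁻¹ := by positivity
    rw [Real.norm_eq_abs]
    simp only [hK, hB, abs_mul]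
    calc |Real.cos (φ x)| * |φ'' x / φ' x ^ 2 * x⁻¹ + (φ' x)⁻¹ * (x ^ 2)⁻¹|
        ≤ 1 * (|φ'' x / φ' x ^ 2 * x⁻¹| + |(φ' x)⁻¹ * (x ^ 2)⁻¹|) := by
          gcongr
          · exact Real.abs_cos_le_one _
          · exact abs_add_le _ _
      _ = φ'' x / φ' x ^ 2 * x⁻¹ + |(φ' x)⁻¹| * (x ^ 2)⁻¹ := by
          rw [abs_mul, abs_mul, abs_of_nonneg hp, abs_of_nonneg hq,
            abs_of_pos (hxinv x hx').1, one_mul]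
      _ ≤ φ'' x / φ' x ^ 2 * α⁻¹ + M⁻¹ * (x ^ 2)⁻¹ := by
          gcongr
          · exact hx'.1
          · exact hinv x hx'
      _ = _ := by ring
  have hα' : α ∈ Set.Icc α β := ⟨le_rfl, hαβ⟩
  have hβ' : β ∈ Set.Icc α β := ⟨hαβ, le_rfl⟩
  have hGb : ∀ x ∈ Set.Icc α β, |G x| ≤ M⁻¹ * α⁻¹ := fun x hx => by
    simp only [hG, abs_mul, abs_neg]
    calc |Real.cos (φ x)| * (|(φ' x)⁻¹| * |x⁻¹|) ≤ 1 * (M⁻¹ * α⁻¹) := by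
          rw [abs_of_pos (hxinv x hx).1]
          exact mul_le_mul (Real.abs_cos_le_one _) (mul_le_mul (hinv x hx) (hxinv x hx).2
            (hxinv x hx).1.le (inv_pos.2 hM).le)
            (mul_nonneg (abs_nonneg _) (hxinv x hx).1.le) zero_le_one
      _ = _ := one_mul _
  have hHb : H β - H α ≤ 3 * (M⁻¹ * α⁻¹) := by
    have h1 := mul_le_mul_of_nonneg_left (abs_le.1 (hinv α hα')).2 (inv_pos.2 hα).le
    have h2 := mul_le_mul_of_nonneg_left (abs_le.1 (hinv β hβ')).1 (inv_pos.2 hα).le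
    have h3 : 0 ≤ M⁻¹ * β⁻¹ := mul_nonneg (inv_pos.2 hM).le (hxinv β hβ').1.le
    simp only [hH]
    linarith
  have e5 : 5 / (M * α) = 5 * (M⁻¹ * α⁻¹) := by
    rw [div_eq_mul_inv, mul_inv]
  rw [e5]
  have g1 := abs_le.1 (hGb α hα')
  have g2 := abs_le.1 (hGb β hβ')
  have g3 := abs_le.1 hKB
  rw [abs_le]
  constructor <;> linarith

lemma sub_sin_nonneg_and_le {x : ℝ} (hx : 0 ≤ x) :
    0 ≤ x / 2 - Real.sin (x / 2) ∧ x / 2 - Real.sin (x / 2) ≤ x ^ 3 / 48 := by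
  refine ⟨sub_nonneg.2 (Real.sin_le (by positivity)), ?_⟩
  have h : ∀ y ∈ Set.Ici (0 : ℝ), HasDerivWithinAt (fun y : ℝ => y ^ 3 / 48 - (y / 2 - Real.sin (y / 2)))
      (y ^ 2 / 16 - (1 - Real.cos (y / 2)) / 2) (Set.Ici 0) y := fun y _ => by
    have h1 : HasDerivAt (fun y : ℝ => y / 2) (1 / 2) y := (hasDerivAt_id y).div_const 2
    refine (((hasDerivAt_pow 3 y).div_const 48).sub (h1.sub h1.sin)).hasDerivWithinAt.congr_deriv ?_
    simp only [Nat.cast_ofNat]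
    ring
  have hmono : MonotoneOn (fun y : ℝ => y ^ 3 / 48 - (y / 2 - Real.sin (y / 2))) (Set.Ici 0) := by
    refine monotoneOn_of_hasDerivWithinAt_nonneg (convex_Ici 0)
      (fun y hy => (h y hy).continuousWithinAt)
      (fun y hy => (h y (interior_subset hy)).mono interior_subset) fun y _ => ?_
    have := Real.one_sub_sq_div_two_le_cos (x := y / 2)
    linarith
  have := hmono Set.self_mem_Ici (Set.mem_Ici.2 hx) hx
  simp only [zero_div, Real.sin_zero] at this
  linarith

lemma div_pi_le_sin_half {x : ℝ} (h0 : 0 ≤ x) (h1 : x ≤ Real.pi) : x / Real.pi ≤ Real.sin (x / 2) := by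
  have := Real.mul_le_sin (x := x / 2) (by positivity) (by linarith)
  calc x / Real.pi = 2 / Real.pi * (x / 2) := by field_simp
    _ ≤ _ := this

/-- A function dominated by `|φ x| ≤ c x` has `sin (φ x) / x` interval integrable from `0`. -/
lemma intervalIntegrable_sin_div {φ : ℝ → ℝ} (hφ : Continuous φ) {c α β : ℝ} (hα : 0 ≤ α) (hαβ : α ≤ β)
    (h : ∀ x, 0 < x → |φ x| ≤ c * x) :
    IntervalIntegrable (fun x => Real.sin (φ x) / x) MeasureTheory.volume α β := by
  rw [intervalIntegrable_iff_integrableOn_Ioc_of_le hαβ]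
  refine MeasureTheory.Measure.integrableOn_of_bounded (M := c) (by simp)
    (Measurable.aestronglyMeasurable (by fun_prop)) ?_
  refine (MeasureTheory.ae_restrict_iff' measurableSet_Ioc).2 (Filter.Eventually.of_forall fun x hx => ?_)
  have hx0 : 0 < x := hα.trans_lt hx.1
  rw [Real.norm_eq_abs, abs_div, abs_of_pos hx0, div_le_iff₀ hx0]
  exact Real.abs_sin_le_abs.trans (h x hx0)

/-- Split at `1 / |a|`: before it `|sin (a x)| ≤ |a| x` gives at most 1; after it the
first-derivative test with `M α = 1` gives 5. -/
lemma abs_integral_sin_mul_div_le (a : ℝ) {δ : ℝ} (hδ : 0 ≤ δ) :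
    |∫ x in (0 : ℝ)..δ, Real.sin (a * x) / x| ≤ 6 := by
  rcases eq_or_ne a 0 with rfl | ha
  · simp
  have ha' : 0 < |a| := abs_pos.2 ha
  have hc : Continuous fun x : ℝ => a * x := by fun_prop
  have hb : ∀ x : ℝ, 0 < x → |a * x| ≤ |a| * x := fun x hx => by rw [abs_mul, abs_of_pos hx]
  have near : ∀ r : ℝ, 0 ≤ r → r ≤ |a|⁻¹ → |∫ x in (0 : ℝ)..r, Real.sin (a * x) / x| ≤ 1 := by
    intro r hr hra
    have := intervalIntegral.norm_integral_le_of_norm_le_const (a := 0) (b := r) (C := |a|)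
      (f := fun x => Real.sin (a * x) / x) fun x hx => by
        rw [Set.uIoc_of_le hr] at hx
        rw [Real.norm_eq_abs, abs_div, abs_of_pos hx.1, div_le_iff₀ hx.1]
        exact Real.abs_sin_le_abs.trans (hb x hx.1)
    rw [Real.norm_eq_abs, sub_zero, abs_of_nonneg hr] at this
    refine this.trans ?_
    calc |a| * r ≤ |a| * |a|⁻¹ := by gcongr
      _ = 1 := mul_inv_cancel₀ ha'.ne'
  rcases le_total δ |a|⁻¹ with hle | hle
  · linarith [near δ hδ hle]
  have hpos : 0 < |a|⁻¹ := inv_pos.2 ha'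
  have far := abs_integral_sin_div_le (φ := fun x => a * x) (φ' := fun _ => a) (φ'' := fun _ => 0)
    hpos hle ha' (fun x => by simpa using (hasDerivAt_id x).const_mul a)
    (fun x => hasDerivAt_const x a) continuous_const (fun _ _ => le_rfl) (fun _ _ => le_rfl)
  rw [mul_inv_cancel₀ ha'.ne', div_one] at far
  rw [← intervalIntegral.integral_add_adjacent_intervals
    (intervalIntegrable_sin_div hc le_rfl hpos.le hb) (intervalIntegrable_sin_div hc hpos.le hle hb)]
  linarith [abs_add_le (∫ x in (0 : ℝ)..|a|⁻¹, Real.sin (a * x) / x)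
    (∫ x in |a|⁻¹..δ, Real.sin (a * x) / x), near _ hpos.le le_rfl]

lemma abs_cubic_phase_le (a : ℝ) {b x : ℝ} (hb : 0 ≤ b) (hx : 0 < x) :
    |a * x + b * (x / 2 - Real.sin (x / 2))| ≤ (|a| + b) * x := by
  have h1 := (sub_sin_nonneg_and_le hx.le).1
  have h2 : x / 2 - Real.sin (x / 2) ≤ x := by
    have := neg_abs_le (Real.sin (x / 2))
    have h3 := Real.abs_sin_le_abs (x := x / 2)
    rw [abs_of_pos (half_pos hx)] at h3
    linarith
  calc _ ≤ |a * x| + |b * (x / 2 - Real.sin (x / 2))| := abs_add_le _ _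
    _ = |a| * x + b * (x / 2 - Real.sin (x / 2)) := by
      rw [abs_mul, abs_of_pos hx, abs_of_nonneg (mul_nonneg hb h1)]
    _ ≤ |a| * x + b * x := by gcongr
    _ = _ := by ring

/-- While `b δ³ ≤ 1` the term `b (x / 2 - sin (x / 2)) = O(b x³)` is a harmless perturbation of the
linear phase: it adds at most 1 to the bound 6. -/
lemma abs_integral_sin_cubic_phase_near_le (a : ℝ) {b δ : ℝ} (hb : 0 ≤ b) (hδ : 0 ≤ δ)
    (h : b * δ ^ 3 ≤ 1) :
    |∫ x in (0 : ℝ)..δ, Real.sin (a * x + b * (x / 2 - Real.sin (x / 2))) / x| ≤ 7 := by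
  have i1 := intervalIntegrable_sin_div (φ := fun x => a * x + b * (x / 2 - Real.sin (x / 2)))
    (by fun_prop) le_rfl hδ fun x hx => abs_cubic_phase_le a hb hx
  have i2 := intervalIntegrable_sin_div (φ := fun x => a * x) (c := |a|)
    (by fun_prop) le_rfl hδ fun x hx => by rw [abs_mul, abs_of_pos hx]
  have hdiff : |∫ x in (0 : ℝ)..δ, (Real.sin (a * x + b * (x / 2 - Real.sin (x / 2))) / x -
      Real.sin (a * x) / x)| ≤ b * δ ^ 2 * |δ - 0| := by
    rw [← Real.norm_eq_abs]
    refine intervalIntegral.norm_integral_le_of_norm_le_const fun x hx => ?_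
    rw [Set.uIoc_of_le hδ] at hx
    have hx0 := hx.1
    have hg := sub_sin_nonneg_and_le hx0.le
    rw [Real.norm_eq_abs, ← sub_div, abs_div, abs_of_pos hx0, div_le_iff₀ hx0]
    calc _ ≤ |a * x + b * (x / 2 - Real.sin (x / 2)) - a * x| := by
            have := Real.lipschitzWith_sin.dist_le_mul (a * x + b * (x / 2 - Real.sin (x / 2))) (a * x)
            rwa [NNReal.coe_one, one_mul, Real.dist_eq, Real.dist_eq] at this
      _ = b * (x / 2 - Real.sin (x / 2)) := by
            rw [add_sub_cancel_left, abs_of_nonneg (mul_nonneg hb hg.1)]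
      _ ≤ b * x ^ 3 := by
            have : 0 ≤ x ^ 3 := by positivity
            gcongr
            linarith
      _ = b * x ^ 2 * x := by ring
      _ ≤ b * δ ^ 2 * x := by
            have := hx.2
            gcongr
  rw [intervalIntegral.integral_sub i1 i2, sub_zero, abs_of_nonneg hδ] at hdiff
  have h2 := abs_integral_sin_mul_div_le a hδ
  have h3 : b * δ ^ 2 * δ ≤ 1 := by linarith [show b * δ ^ 2 * δ = b * δ ^ 3 by ring]
  rw [abs_le] at *
  constructor <;> linarith

/-- Beyond the scale `δ = b^(-1/3)` the phase is strictly convex. Excise a window of radius `δ`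
around the point where `φ'` is closest to zero: the window is bounded trivially, and the
first-derivative test handles both sides. -/
lemma abs_integral_sin_cubic_phase_far_le (a : ℝ) {b δ : ℝ} (hb : 0 ≤ b) (hδ : 0 < δ)
    (hδπ : δ ≤ Real.pi) (h : b * δ ^ 3 = 1) :
    |∫ x in δ..Real.pi, Real.sin (a * x + b * (x / 2 - Real.sin (x / 2))) / x| ≤
      40 * Real.pi + 2 := by
  have hπ := Real.pi_pos
  set φ : ℝ → ℝ := fun x => a * x + b * (x / 2 - Real.sin (x / 2)) with hφd
  set φ' : ℝ → ℝ := fun x => a + b * ((1 - Real.cos (x / 2)) / 2) with hφ'd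
  set φ'' : ℝ → ℝ := fun x => b * (Real.sin (x / 2) / 4) with hφ''d
  set κ : ℝ := b * (δ / Real.pi / 4) with hκ
  have half : ∀ x : ℝ, HasDerivAt (fun x : ℝ => x / 2) (1 / 2) x := fun x =>
    (hasDerivAt_id x).div_const 2
  have dφ : ∀ x, HasDerivAt φ (φ' x) x := fun x => by
    refine (((hasDerivAt_id x).const_mul a).add
      (((half x).sub (half x).sin).const_mul b)).congr_deriv ?_
    simp only [hφ'd]
    ring
  have dφ' : ∀ x, HasDerivAt φ' (φ'' x) x := fun x => by
    refine (((((half x).cos.const_sub 1).div_const 2).const_mul b).const_add a).congr_deriv ?_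
    simp only [hφ''d]
    ring
  have hint : ∀ α β, 0 ≤ α → α ≤ β →
      IntervalIntegrable (fun x => Real.sin (φ x) / x) MeasureTheory.volume α β :=
    fun α β hα hαβ => intervalIntegrable_sin_div (by fun_prop) hα hαβ
      fun x hx => abs_cubic_phase_le a hb hx
  have hκ'' : ∀ x ∈ Set.Icc δ Real.pi, κ ≤ φ'' x := fun x hx => by
    simp only [hκ, hφ''d]
    have h1 := div_pi_le_sin_half (hδ.le.trans hx.1) hx.2
    have h2 : δ / Real.pi ≤ x / Real.pi := by
      have := hx.1
      gcongr
    gcongr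
    linarith
  have hκ0 : 0 ≤ κ := by positivity
  have gap : ∀ x y, δ ≤ x → x ≤ y → y ≤ Real.pi → κ * (y - x) ≤ φ' y - φ' x := by
    intro x y hx hxy hy
    refine (convex_Icc δ Real.pi).mul_sub_le_image_sub_of_le_deriv
      (fun z _ => (dφ' z).continuousAt.continuousWithinAt)
      (fun z _ => (dφ' z).differentiableAt.differentiableWithinAt)
      (fun z hz => ?_) x ⟨hx, hxy.trans hy⟩ y ⟨hx.trans hxy, hy⟩ hxy
    rw [(dφ' z).deriv]
    exact hκ'' z (interior_subset hz)
  -- `c` is the zero of the increasing function `φ'`, or the endpoint nearest to it if `φ'` keeps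
  -- its sign. In the alternatives `c = δ` and `c = π` the corresponding outer piece is empty.
  obtain ⟨c, hcI, hcl, hcr⟩ : ∃ c ∈ Set.Icc δ Real.pi, (c = δ ∨ φ' c ≤ 0) ∧
      (c = Real.pi ∨ 0 ≤ φ' c) := by
    rcases le_total 0 (φ' δ) with h0 | h0
    · exact ⟨δ, ⟨le_rfl, hδπ⟩, Or.inl rfl, Or.inr h0⟩
    rcases le_total (φ' Real.pi) 0 with h1 | h1
    · exact ⟨Real.pi, ⟨hδπ, le_rfl⟩, Or.inr h1, Or.inl rfl⟩
    · obtain ⟨c, hc, hc0⟩ := intermediate_value_Icc hδπ (f := φ')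
        (fun z _ => (dφ' z).continuousAt.continuousWithinAt) ⟨h0, h1⟩
      exact ⟨c, hc, Or.inr hc0.le, Or.inr hc0.ge⟩
  -- At distance at least `δ` from `c` one has `|φ'| ≥ κ δ`. The relation `b δ³ = 1` makes this `1 /
  -- (4 π δ)`, so the bound `5 / (κ δ · δ)` no longer depends on `b`.
  have hM : κ * δ = 1 / (4 * Real.pi * δ) := by
    rw [hκ, eq_div_iff (by positivity)]
    calc b * (δ / Real.pi / 4) * δ * (4 * Real.pi * δ) = b * δ ^ 3 := by field_simp
      _ = 1 := h
  have hMpos : 0 < κ * δ := by rw [hM]; positivity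
  have hfin : 5 / (κ * δ * δ) = 20 * Real.pi := by
    rw [hM]; field_simp; norm_num
  have outer : ∀ α β, δ ≤ α → α ≤ β → β ≤ Real.pi → (∀ x ∈ Set.Icc α β, κ * δ ≤ |φ' x|) →
      |∫ x in α..β, Real.sin (φ x) / x| ≤ 20 * Real.pi := by
    intro α β hα hαβ hβ hx
    refine (abs_integral_sin_div_le (hδ.trans_le hα) hαβ hMpos dφ dφ' (by fun_prop)
      (fun x hx => hκ0.trans (hκ'' x ⟨hα.trans hx.1, hx.2.trans hβ⟩)) hx).trans ?_
    rw [← hfin]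
    gcongr
  have hx1 : δ ≤ max δ (c - δ) := le_max_left _ _
  have hx1c : max δ (c - δ) ≤ c := max_le hcI.1 (by linarith)
  have hx2c : c ≤ min Real.pi (c + δ) := le_min hcI.2 (by linarith)
  have hx2 : min Real.pi (c + δ) ≤ Real.pi := min_le_left _ _
  have hl : |∫ x in δ..max δ (c - δ), Real.sin (φ x) / x| ≤ 20 * Real.pi := by
    rcases le_total (c - δ) δ with hle | hle
    · rw [max_eq_left hle, intervalIntegral.integral_same, abs_zero]
      positivity
    · rw [max_eq_right hle]
      refine outer δ (c - δ) le_rfl hle (by linarith [hcI.2]) fun x hx => ?_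
      have hcx : φ' c ≤ 0 := hcl.resolve_left fun hc => by linarith
      have h1 := gap x c hx.1 (by linarith [hx.2]) hcI.2
      have h2 : κ * δ ≤ κ * (c - x) := by
        gcongr
        linarith [hx.2]
      rw [abs_of_nonpos (by linarith)]
      linarith
  have hr : |∫ x in min Real.pi (c + δ)..Real.pi, Real.sin (φ x) / x| ≤ 20 * Real.pi := by
    rcases le_total Real.pi (c + δ) with hle | hle
    · rw [min_eq_left hle, intervalIntegral.integral_same, abs_zero]
      positivity
    · rw [min_eq_right hle]
      refine outer (c + δ) Real.pi (by linarith [hcI.1]) hle le_rfl fun x hx => ?_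
      have hcx : 0 ≤ φ' c := hcr.resolve_left fun hc => by linarith
      have h1 := gap c x hcI.1 (by linarith [hx.1]) hx.2
      have h2 : κ * δ ≤ κ * (x - c) := by
        gcongr
        linarith [hx.1]
      rw [abs_of_nonneg (by linarith)]
      linarith
  -- The window has length at most `2 δ` and the integrand is at most `1 / δ` there.
  have hm : |∫ x in max δ (c - δ)..min Real.pi (c + δ), Real.sin (φ x) / x| ≤ 2 := by
    have hle := hx1c.trans hx2c
    have := intervalIntegral.norm_integral_le_of_norm_le_const (a := max δ (c - δ))
      (b := min Real.pi (c + δ)) (C := δ⁻¹) (f := fun x => Real.sin (φ x) / x) fun x hx => by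
        rw [Set.uIoc_of_le hle] at hx
        have hx0 : δ ≤ x := hx1.trans hx.1.le
        rw [Real.norm_eq_abs, abs_div, abs_of_pos (hδ.trans_le hx0), ← one_div]
        exact div_le_div₀ zero_le_one (Real.abs_sin_le_one _) hδ hx0
    rw [Real.norm_eq_abs, abs_of_nonneg (sub_nonneg.2 hle)] at this
    refine this.trans ?_
    rw [inv_mul_le_iff₀ hδ]
    linarith [le_max_right δ (c - δ), min_le_right Real.pi (c + δ)]
  have e1 := intervalIntegral.integral_add_adjacent_intervals
    (hint δ _ hδ.le hx1) (hint _ _ (hδ.le.trans hx1) (hx1c.trans hx2c))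
  have e2 := intervalIntegral.integral_add_adjacent_intervals
    (hint δ _ hδ.le (hx1.trans (hx1c.trans hx2c)))
    (hint _ _ (hδ.le.trans (hx1.trans (hx1c.trans hx2c))) hx2)
  rw [abs_le] at *
  constructor <;> linarith

/-- Near and far bounds are joined at `δ = b^(-1/3)`; if this scale exceeds `π`, the near bound
alone covers the interval. -/
lemma abs_integral_sin_cubic_phase_le (a : ℝ) {b : ℝ} (hb : 0 ≤ b) :
    |∫ x in (0 : ℝ)..Real.pi, Real.sin (a * x + b * (x / 2 - Real.sin (x / 2))) / x| ≤
      40 * Real.pi + 9 := by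
  have hπ := Real.pi_pos
  rcases le_total (b * Real.pi ^ 3) 1 with h | h
  · linarith [abs_integral_sin_cubic_phase_near_le a hb hπ.le h]
  have hb0 : 0 < b := by
    rcases hb.eq_or_lt with rfl | h0
    · norm_num at h
    · exact h0
  set δ : ℝ := (b⁻¹) ^ ((3 : ℝ)⁻¹) with hδd
  have hδ : 0 < δ := by positivity
  have h3 : δ ^ 3 = b⁻¹ := by
    rw [hδd, ← Real.rpow_natCast, ← Real.rpow_mul (inv_pos.2 hb0).le]
    norm_num
  have hbδ : b * δ ^ 3 = 1 := by rw [h3, mul_inv_cancel₀ hb0.ne']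
  have hδπ : δ ≤ Real.pi := by
    refine le_of_pow_le_pow_left₀ three_ne_zero hπ.le ?_
    rw [h3, inv_le_iff_one_le_mul₀' hb0]
    exact h
  have hint : ∀ α β, 0 ≤ α → α ≤ β → IntervalIntegrable
      (fun x => Real.sin (a * x + b * (x / 2 - Real.sin (x / 2))) / x) MeasureTheory.volume α β :=
    fun α β hα hαβ => intervalIntegrable_sin_div (by fun_prop) hα hαβ
      fun x hx => abs_cubic_phase_le a hb hx
  rw [← intervalIntegral.integral_add_adjacent_intervals (hint 0 δ le_rfl hδ.le)
    (hint δ _ hδ.le hδπ)]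
  refine (abs_add_le _ _).trans ?_
  linarith [abs_integral_sin_cubic_phase_near_le a hb hδ.le hbδ.le,
    abs_integral_sin_cubic_phase_far_le a hb hδ hδπ hbδ]

/-- Moving the linear part `τ x / 2` of `τ sin (x / 2)` into `κ x` leaves the cubic remainder with
coefficient `-τ`; oddness of the sine makes that coefficient nonnegative. -/
lemma abs_integral_sin_phase_le (κ τ : ℝ) :
    |∫ x in (0 : ℝ)..Real.pi, Real.sin (κ * x + τ * Real.sin (x / 2)) / x| ≤
      40 * Real.pi + 9 := by
  rcases le_total 0 τ with h | h
  · have := abs_integral_sin_cubic_phase_le (-(κ + τ / 2)) h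
    rw [← abs_neg, ← intervalIntegral.integral_neg]
    convert this using 5 with x
    rw [← neg_div, ← Real.sin_neg]
    congr 2
    ring
  · have := abs_integral_sin_cubic_phase_le (κ + τ / 2) (neg_nonneg.2 h)
    convert this using 6 with x
    ring

lemma intervalIntegrable_sin_phase (κ τ : ℝ) :
    IntervalIntegrable (fun x => Real.sin (κ * x + τ * Real.sin (x / 2)) / x)
      MeasureTheory.volume 0 Real.pi := by
  refine intervalIntegrable_sin_div (c := |κ| + |τ|) (by fun_prop) le_rfl Real.pi_pos.le fun x hx => ?_
  have h : |Real.sin (x / 2)| ≤ x := by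
    have h3 := Real.abs_sin_le_abs (x := x / 2)
    rw [abs_of_pos (half_pos hx)] at h3
    linarith
  calc _ ≤ |κ * x| + |τ * Real.sin (x / 2)| := abs_add_le _ _
    _ = |κ| * x + |τ| * |Real.sin (x / 2)| := by rw [abs_mul, abs_mul, abs_of_pos hx]
    _ ≤ |κ| * x + |τ| * x := by gcongr
    _ = _ := by ring

/-! ### Uniqueness of locally bounded solutions -/

lemma abs_le_of_hasDerivWithinAt_Ici {f f' : ℝ → ℝ} {K T : ℝ} {m : ℕ} (h0 : f 0 = 0)
    (hf : ∀ t, 0 ≤ t → HasDerivWithinAt f (f' t) (Set.Ici 0) t)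
    (hb : ∀ t ∈ Set.Icc 0 T, |f' t| ≤ K * t ^ m) :
    ∀ t ∈ Set.Icc 0 T, |f t| ≤ K * (t ^ (m + 1) / (m + 1)) := by
  intro t ht
  refine image_norm_le_of_norm_deriv_right_le_deriv_boundary (f := f) (f' := f') (a := 0) (b := T)
    (B := fun t => K * (t ^ (m + 1) / (m + 1))) (B' := fun t => K * t ^ m) (fun s hs =>
      ((hf s hs.1).continuousWithinAt).mono fun r hr => hr.1)
    (fun s hs => (hf s hs.1).mono fun r hr => hs.1.trans hr) (by simp [h0]) (fun s => ?_)
    (fun s hs => hb s ⟨hs.1, hs.2.le⟩) ht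
  have hm : (m + 1 : ℝ) ≠ 0 := by positivity
  refine (((hasDerivAt_pow (m + 1) s).div_const (m + 1 : ℝ)).const_mul K).congr_deriv ?_
  push_cast
  rw [mul_div_cancel_left₀ _ hm]

lemma abs_discreteLaplacian_le {d : ℤ → ℝ} {B : ℝ} (h : ∀ k, |d k| ≤ B) (k : ℤ) :
    |discreteLaplacian d k| ≤ 4 * B := by
  have h1 := abs_le.1 (h (k + 1))
  have h2 := abs_le.1 (h k)
  have h3 := abs_le.1 (h (k - 1))
  rw [discreteLaplacian, abs_le]
  constructor <;> linarith

/-- A bounded solution of the chain with zero initial data vanishes. -/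
lemma chain_eq_zero {ω C T : ℝ} {d e : ℝ → ℤ → ℝ} (hd0 : d 0 = 0) (he0 : e 0 = 0)
    (hd : ∀ t : ℝ, 0 ≤ t → ∀ k : ℤ, HasDerivWithinAt (fun s => d s k) (e t k) (Set.Ici 0) t)
    (he : ∀ t : ℝ, 0 ≤ t → ∀ k : ℤ,
      HasDerivWithinAt (fun s => e s k) (ω ^ 2 * discreteLaplacian (d t) k) (Set.Ici 0) t)
    (hC : ∀ t ∈ Set.Icc 0 T, ∀ k, |d t k| ≤ C) : ∀ t ∈ Set.Icc 0 T, d t = 0 := by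
  -- Each turn of the induction feeds the bound through `ω² Δ`, of norm at most `4 ω²`, and
  -- integrates twice in time. The result is `C` times a term of the exponential series at `2 ω t`,
  -- which tends to 0.
  have key : ∀ n : ℕ, ∀ t ∈ Set.Icc 0 T, ∀ k,
      |d t k| ≤ C * (4 * ω ^ 2) ^ n / ((2 * n).factorial : ℝ) * t ^ (2 * n) := by
    intro n
    induction n with
    | zero => simpa using hC
    | succ n ih =>
      set K : ℝ := C * (4 * ω ^ 2) ^ n / ((2 * n).factorial : ℝ) with hK
      have h1 : ∀ k, ∀ t ∈ Set.Icc 0 T,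
          |e t k| ≤ 4 * ω ^ 2 * K / (2 * n + 1) * t ^ (2 * n + 1) := fun k t ht => by
        have := abs_le_of_hasDerivWithinAt_Ici (f := fun s => e s k) (K := 4 * ω ^ 2 * K)
          (m := 2 * n) (congrFun he0 k) (fun t ht => he t ht k) (fun t ht => by
            have := abs_discreteLaplacian_le (ih t ht) k
            rw [abs_mul, abs_of_nonneg (sq_nonneg ω)]
            calc _ ≤ ω ^ 2 * (4 * (K * t ^ (2 * n))) := by gcongr
              _ = _ := by ring) t ht
        refine this.trans_eq ?_
        push_cast
        ring
      intro t ht k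
      have := abs_le_of_hasDerivWithinAt_Ici (f := fun s => d s k)
        (congrFun hd0 k) (fun t ht => hd t ht k) (h1 k) t ht
      refine this.trans_eq ?_
      have e1 : 2 * (n + 1) = 2 * n + 1 + 1 := by ring
      rw [e1, Nat.factorial_succ, Nat.factorial_succ, hK]
      push_cast
      have : ((2 * n).factorial : ℝ) ≠ 0 := by positivity
      field_simp
      ring
  intro t ht
  funext k
  have hlim : Filter.Tendsto (fun n : ℕ => C * ((2 * ω * t) ^ (2 * n) / ((2 * n).factorial : ℝ)))
      Filter.atTop (nhds (C * 0)) := by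
    refine Filter.Tendsto.const_mul C ?_
    exact (FloorSemiring.tendsto_pow_div_factorial_atTop (2 * ω * t)).comp
      (Filter.tendsto_id.const_mul_atTop' two_pos)
  rw [mul_zero] at hlim
  have hle : |d t k| ≤ 0 := ge_of_tendsto' hlim fun n => (key n t ht k).trans_eq <| by
    have e : (2 * ω * t) ^ (2 * n) = (4 * ω ^ 2) ^ n * t ^ (2 * n) := by
      rw [pow_mul, pow_mul, ← mul_pow]
      congr 1
      ring
    rw [e]
    ring
  exact abs_nonpos_iff.1 hle

lemma IsChainSolution.unique {ω : ℝ} {q₀ : ℤ → ℝ} {q p q' p' : ℝ → ℤ → ℝ}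
    (h : IsChainSolution ω q₀ q p) (h' : IsChainSolution ω q₀ q' p') {t : ℝ} (ht : 0 ≤ t) :
    q' t = q t := by
  obtain ⟨C, hC⟩ := h.locally_bounded t ht
  obtain ⟨C', hC'⟩ := h'.locally_bounded t ht
  have := chain_eq_zero (ω := ω) (C := C' + C) (T := t) (d := fun s k => q' s k - q s k)
    (e := fun s k => p' s k - p s k) (by funext k; simp [h.init_pos, h'.init_pos])
    (by funext k; simp [h.init_vel, h'.init_vel])
    (fun s hs k => (h'.hasDeriv_pos s hs k).sub (h.hasDeriv_pos s hs k))
    (fun s hs k => ((h'.hasDeriv_vel s hs k).sub (h.hasDeriv_vel s hs k)).congr_deriv <| by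
      simp only [discreteLaplacian]
      ring)
    (fun s hs k => (abs_sub _ _).trans (add_le_add (hC' s hs k) (hC s hs k)))
    t ⟨ht, le_rfl⟩
  funext k
  exact sub_eq_zero.1 (congrFun this k)

/-! ### Time multipliers and differentiation under the integral -/

/-- The multiplier `(cos (2 ω t s) - 1) / (4 s²)`, `s = sin (x / 2)`, of the position. -/
noncomputable def posMultiplier (ω t x : ℝ) : ℝ :=
  (Real.cos (2 * ω * t * Real.sin (x / 2)) - 1) / (4 * Real.sin (x / 2) ^ 2)

/-- The multiplier `-ω sin (2 ω t s) / (2 s)`, `s = sin (x / 2)`, of the velocity. -/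
noncomputable def velMultiplier (ω t x : ℝ) : ℝ :=
  -(ω * Real.sin (2 * ω * t * Real.sin (x / 2))) / (2 * Real.sin (x / 2))

lemma sin_half_pos {x : ℝ} (hx : x ∈ Set.Ioc 0 Real.pi) : 0 < Real.sin (x / 2) :=
  Real.sin_pos_of_pos_of_lt_pi (half_pos hx.1) (by linarith [hx.2, Real.pi_pos])

lemma hasDerivAt_posMultiplier (ω t : ℝ) {x : ℝ} (hx : x ∈ Set.Ioc 0 Real.pi) :
    HasDerivAt (fun t => posMultiplier ω t x) (velMultiplier ω t x) t := by
  have hs := (sin_half_pos hx).ne'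
  have h1 : HasDerivAt (fun t => 2 * ω * t * Real.sin (x / 2)) (2 * ω * Real.sin (x / 2)) t := by
    simpa using ((hasDerivAt_id t).const_mul (2 * ω)).mul_const (Real.sin (x / 2))
  refine ((h1.cos.sub_const 1).div_const _).congr_deriv ?_
  rw [velMultiplier]
  field_simp
  ring

lemma hasDerivAt_velMultiplier (ω t : ℝ) {x : ℝ} (hx : x ∈ Set.Ioc 0 Real.pi) :
    HasDerivAt (fun t => velMultiplier ω t x)
      (-(ω ^ 2 * Real.cos (2 * ω * t * Real.sin (x / 2)))) t := by
  have hs := (sin_half_pos hx).ne'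
  have h1 : HasDerivAt (fun t => 2 * ω * t * Real.sin (x / 2)) (2 * ω * Real.sin (x / 2)) t := by
    simpa using ((hasDerivAt_id t).const_mul (2 * ω)).mul_const (Real.sin (x / 2))
  refine (((h1.sin.const_mul ω).neg).div_const _).congr_deriv ?_
  field_simp

lemma abs_posMultiplier_le (ω t : ℝ) {x : ℝ} (hx : x ∈ Set.Ioc 0 Real.pi) :
    |posMultiplier ω t x| ≤ ω ^ 2 * t ^ 2 / 2 := by
  have hs := sin_half_pos hx
  have h1 := Real.one_sub_sq_div_two_le_cos (x := 2 * ω * t * Real.sin (x / 2))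
  have h2 := Real.cos_le_one (2 * ω * t * Real.sin (x / 2))
  rw [posMultiplier, abs_div, abs_of_nonpos (by linarith), abs_of_pos (by positivity),
    div_le_iff₀ (by positivity)]
  linarith [show ω ^ 2 * t ^ 2 / 2 * (4 * Real.sin (x / 2) ^ 2) =
    (2 * ω * t * Real.sin (x / 2)) ^ 2 / 2 by ring]

lemma abs_velMultiplier_le (ω t : ℝ) {x : ℝ} (hx : x ∈ Set.Ioc 0 Real.pi) :
    |velMultiplier ω t x| ≤ ω ^ 2 * |t| := by
  have hs := sin_half_pos hx
  rw [velMultiplier, abs_div, abs_neg, abs_mul, abs_of_pos (mul_pos two_pos hs),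
    div_le_iff₀ (by positivity)]
  calc _ ≤ |ω| * |2 * ω * t * Real.sin (x / 2)| := by
        exact mul_le_mul_of_nonneg_left Real.abs_sin_le_abs (abs_nonneg ω)
    _ = ω ^ 2 * |t| * (2 * Real.sin (x / 2)) := by
        rw [abs_mul, abs_mul, abs_mul, abs_two, abs_of_pos hs, ← sq_abs ω]
        ring

@[fun_prop]
lemma measurable_posMultiplier (ω t : ℝ) : Measurable (posMultiplier ω t) := by
  unfold posMultiplier
  fun_prop

@[fun_prop]
lemma measurable_velMultiplier (ω t : ℝ) : Measurable (velMultiplier ω t) := by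
  unfold velMultiplier
  fun_prop

lemma intervalIntegrable_bounded_mul {m w : ℝ → ℝ} {c : ℝ} (hm : Measurable m)
    (hw : IntervalIntegrable w MeasureTheory.volume 0 Real.pi)
    (h : ∀ x ∈ Set.Ioc 0 Real.pi, |m x| ≤ c) :
    IntervalIntegrable (fun x => m x * w x) MeasureTheory.volume 0 Real.pi := by
  rw [intervalIntegrable_iff_integrableOn_Ioc_of_le Real.pi_pos.le] at hw ⊢
  exact hw.bdd_mul hm.aestronglyMeasurable
    ((MeasureTheory.ae_restrict_iff' measurableSet_Ioc).2 (Filter.Eventually.of_forall h))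

lemma hasDerivAt_integral_mul {m m' : ℝ → ℝ → ℝ} {w : ℝ → ℝ} {t c c' : ℝ}
    (hw : IntervalIntegrable w MeasureTheory.volume 0 Real.pi)
    (hm : ∀ s, Measurable (m s)) (hm' : Measurable (m' t))
    (hb : ∀ x ∈ Set.Ioc 0 Real.pi, |m t x| ≤ c)
    (hb' : ∀ s ∈ Metric.ball t 1, ∀ x ∈ Set.Ioc 0 Real.pi, |m' s x| ≤ c')
    (hd : ∀ s, ∀ x ∈ Set.Ioc 0 Real.pi, HasDerivAt (fun s => m s x) (m' s x) s) :
    HasDerivAt (fun s => ∫ x in (0 : ℝ)..Real.pi, m s x * w x)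
      (∫ x in (0 : ℝ)..Real.pi, m' t x * w x) t := by
  have hI : Set.uIoc 0 Real.pi = Set.Ioc 0 Real.pi := Set.uIoc_of_le Real.pi_pos.le
  have hwm : MeasureTheory.AEStronglyMeasurable w
      (MeasureTheory.volume.restrict (Set.uIoc 0 Real.pi)) := by
    rw [hI]; exact hw.1.aestronglyMeasurable
  refine (intervalIntegral.hasDerivAt_integral_of_dominated_loc_of_deriv_le
    (F := fun s x => m s x * w x) (F' := fun s x => m' s x * w x)
    (bound := fun x => c' * |w x|) (Metric.ball_mem_nhds t one_pos)
    (Filter.Eventually.of_forall fun s => (hm s).aestronglyMeasurable.mul hwm)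
    (intervalIntegrable_bounded_mul (hm t) hw hb) (hm'.aestronglyMeasurable.mul hwm)
    (Filter.Eventually.of_forall fun x hx s hs => ?_) (hw.norm.const_mul c')
    (Filter.Eventually.of_forall fun x hx s _ => ?_)).2
  · rw [hI] at hx
    rw [Real.norm_eq_abs, abs_mul]
    exact mul_le_mul_of_nonneg_right (hb' s hs x hx) (abs_nonneg _)
  · rw [hI] at hx
    exact (hd s x hx).mul_const _

/-! ### Uniform bound of the displacement -/

/-- Both terms have the same simple pole at 0: over the common denominator `4 s² x`, of order `x³`,
the numerator `x² - 4 s²` is of order `x⁴`. -/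
lemma abs_weight_sub_inv_le {x : ℝ} (hx : x ∈ Set.Ioc 0 Real.pi) :
    |x / (4 * Real.sin (x / 2) ^ 2) - 1 / x| ≤ 2 := by
  have hs := sin_half_pos hx
  have hx0 := hx.1
  have hπ := Real.pi_pos
  have h1 := sub_sin_nonneg_and_le hx0.le
  have h2 : x ≤ Real.pi * Real.sin (x / 2) := by
    have := div_pi_le_sin_half hx0.le hx.2
    rwa [div_le_iff₀' hπ] at this
  set s := Real.sin (x / 2) with hsd
  have h3 : x ^ 2 ≤ 16 * s ^ 2 := by
    have : x ≤ 4 * s := h2.trans (by nlinarith [Real.pi_le_four])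
    calc x ^ 2 ≤ (4 * s) ^ 2 := by gcongr
      _ = _ := by ring
  have h4 : (x - 2 * s) * (x + 2 * s) ≤ (x ^ 3 / 24) * (2 * x) := by
    have : 0 ≤ x + 2 * s := by positivity
    have h5 : 0 ≤ x ^ 3 / 24 := by positivity
    apply mul_le_mul <;> linarith
  have h6 : x ≤ 4 := hx.2.trans Real.pi_le_four
  have e : x / (4 * s ^ 2) - 1 / x = (x - 2 * s) * (x + 2 * s) / (4 * s ^ 2 * x) := by
    field_simp
    ring
  have h0 : 0 ≤ (x - 2 * s) * (x + 2 * s) := mul_nonneg (by linarith) (by linarith)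
  rw [e, abs_of_nonneg (by positivity), div_le_iff₀ (by positivity)]
  have h7 : x ^ 3 / 24 * (2 * x) ≤ 2 * (4 * s ^ 2 * x) := by
    have h8 : x ^ 2 * (x ^ 2 / 12) ≤ (16 * s ^ 2) * (x / 3) := by
      apply mul_le_mul h3 _ (by positivity) (by positivity)
      nlinarith
    have : 0 ≤ s ^ 2 * x := by positivity
    linarith [show x ^ 3 / 24 * (2 * x) = x ^ 2 * (x ^ 2 / 12) by ring,
      show 16 * s ^ 2 * (x / 3) = 16 / 3 * (s ^ 2 * x) by ring]
  linarith

lemma abs_cos_sub_one_le (y : ℝ) : |Real.cos y - 1| ≤ 2 := by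
  rw [abs_le]
  constructor <;> linarith [Real.neg_one_le_cos y, Real.cos_le_one y]

/-- The product formula writes the integrand as the mean of the phases `κ x ± τ sin (x / 2)` minus
the phase `κ x`, so the uniform bound enters with total weight 2. -/
lemma abs_integral_cos_sub_one_mul_sin_div_le (κ τ : ℝ) :
    |∫ x in (0 : ℝ)..Real.pi, (Real.cos (τ * Real.sin (x / 2)) - 1) * Real.sin (κ * x) / x| ≤
      2 * (40 * Real.pi + 9) := by
  have h1 := abs_le.1 (abs_integral_sin_phase_le κ τ)
  have h2 := abs_le.1 (abs_integral_sin_phase_le κ (-τ))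
  have h3 := abs_le.1 (abs_integral_sin_phase_le κ 0)
  have i1 := (intervalIntegrable_sin_phase κ τ).const_mul (1 / 2)
  have i2 := (intervalIntegrable_sin_phase κ (-τ)).const_mul (1 / 2)
  have i3 := intervalIntegrable_sin_phase κ 0
  have e : (fun x : ℝ => (Real.cos (τ * Real.sin (x / 2)) - 1) * Real.sin (κ * x) / x) = fun x =>
      1 / 2 * (Real.sin (κ * x + τ * Real.sin (x / 2)) / x) +
      1 / 2 * (Real.sin (κ * x + -τ * Real.sin (x / 2)) / x) -
      Real.sin (κ * x + 0 * Real.sin (x / 2)) / x := by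
    funext x
    rw [zero_mul, add_zero, neg_mul, Real.sin_add, ← sub_eq_add_neg, Real.sin_sub]
    ring
  rw [e, intervalIntegral.integral_sub (i1.add i2) i3, intervalIntegral.integral_add i1 i2,
    intervalIntegral.integral_const_mul, intervalIntegral.integral_const_mul, abs_le]
  constructor <;> linarith

lemma intervalIntegrable_cos_sub_one_mul_sin_div (κ τ : ℝ) :
    IntervalIntegrable (fun x => (Real.cos (τ * Real.sin (x / 2)) - 1) * Real.sin (κ * x) / x)
      MeasureTheory.volume 0 Real.pi := by
  have i := intervalIntegrable_bounded_mul (m := fun x => Real.cos (τ * Real.sin (x / 2)) - 1)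
    (by fun_prop) (intervalIntegrable_sin_phase κ 0) (fun x _ => abs_cos_sub_one_le _)
  refine i.congr fun x _ => ?_
  simp only [zero_mul, add_zero]
  ring

section
variable {u v : ℝ → ℝ} {A : ℝ}

lemma intervalIntegrable_trig_combination
    (hu : IntervalIntegrable u MeasureTheory.volume 0 Real.pi)
    (hv : IntervalIntegrable v MeasureTheory.volume 0 Real.pi) (κ : ℝ) :
    IntervalIntegrable (fun x => u x * Real.cos (κ * x) + v x * Real.sin (κ * x))
      MeasureTheory.volume 0 Real.pi :=
  (hu.mul_continuousOn (by fun_prop)).add (hv.mul_continuousOn (by fun_prop))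

lemma intervalIntegrable_of_div_sq {c : ℝ → ℝ} (hc : Continuous c)
    (h : IntervalIntegrable (fun x => (u x - c x) / x ^ 2) MeasureTheory.volume 0 Real.pi) :
    IntervalIntegrable u MeasureTheory.volume 0 Real.pi := by
  refine ((h.continuousOn_mul (g := fun x => x ^ 2) (by fun_prop)).add
    (hc.intervalIntegrable 0 Real.pi)).congr fun x hx => ?_
  rw [Set.uIoc_of_le Real.pi_pos.le] at hx
  have := hx.1.ne'
  field_simp
  ring

/-- Uniform bound of the displacement, in terms of the singular behaviour of the spectral data
`u + i v ≈ i A x` at the origin. -/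
lemma abs_integral_posMultiplier_mul_le
    (hu : IntervalIntegrable (fun x => u x / x ^ 2) MeasureTheory.volume 0 Real.pi)
    (hv : IntervalIntegrable (fun x => (v x - A * x) / x ^ 2) MeasureTheory.volume 0 Real.pi) :
    ∃ C, ∀ ω t κ : ℝ, |∫ x in (0 : ℝ)..Real.pi,
      posMultiplier ω t x * (u x * Real.cos (κ * x) + v x * Real.sin (κ * x))| ≤ C := by
  have hπ := Real.pi_pos
  have hu' : IntervalIntegrable u MeasureTheory.volume 0 Real.pi :=
    intervalIntegrable_of_div_sq (c := fun _ => 0) continuous_const (by simpa using hu)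
  have hv' := intervalIntegrable_of_div_sq (by fun_prop) hv
  -- A majorant, free of `ω`, `t` and `κ`, for what remains after removing the `A / x` term. The
  -- factor `π² / 2` bounds `(cos (2ωts) - 1) x² / (4 s²)` through `x ≤ π s`; the 4 is the bound 2
  -- of `|cos - 1|` times the bound 2 of `abs_weight_sub_inv_le`.
  set g : ℝ → ℝ := fun x =>
    Real.pi ^ 2 / 2 * (|u x / x ^ 2| + |(v x - A * x) / x ^ 2|) + |A| * 4 with hg
  have ig : IntervalIntegrable g MeasureTheory.volume 0 Real.pi :=
    ((hu.norm.add hv.norm).const_mul _).add intervalIntegrable_const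
  refine ⟨(∫ x in (0 : ℝ)..Real.pi, g x) + |A| * (2 * (40 * Real.pi + 9)), fun ω t κ => ?_⟩
  have i1 : IntervalIntegrable (fun x =>
      posMultiplier ω t x * (u x * Real.cos (κ * x) + v x * Real.sin (κ * x)))
      MeasureTheory.volume 0 Real.pi :=
    intervalIntegrable_bounded_mul (measurable_posMultiplier ω t)
      (intervalIntegrable_trig_combination hu' hv' κ) fun x hx => abs_posMultiplier_le ω t hx
  have i2 := (intervalIntegrable_cos_sub_one_mul_sin_div κ (2 * ω * t)).const_mul A
  have hdiff := intervalIntegral.norm_integral_le_of_norm_le (μ := MeasureTheory.volume)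
    (f := fun x => posMultiplier ω t x * (u x * Real.cos (κ * x) + v x * Real.sin (κ * x)) -
      A * ((Real.cos (2 * ω * t * Real.sin (x / 2)) - 1) * Real.sin (κ * x) / x)) hπ.le
    (Filter.Eventually.of_forall fun x hx => ?_) ig
  · rw [intervalIntegral.integral_sub i1 i2, intervalIntegral.integral_const_mul,
      Real.norm_eq_abs] at hdiff
    have hA : |A * ∫ x in (0 : ℝ)..Real.pi,
        (Real.cos (2 * ω * t * Real.sin (x / 2)) - 1) * Real.sin (κ * x) / x| ≤
        |A| * (2 * (40 * Real.pi + 9)) := by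
      rw [abs_mul]
      exact mul_le_mul_of_nonneg_left (abs_integral_cos_sub_one_mul_sin_div_le κ _) (abs_nonneg A)
    linarith [abs_sub_abs_le_abs_sub (∫ x in (0 : ℝ)..Real.pi,
      posMultiplier ω t x * (u x * Real.cos (κ * x) + v x * Real.sin (κ * x)))
      (A * ∫ x in (0 : ℝ)..Real.pi,
        (Real.cos (2 * ω * t * Real.sin (x / 2)) - 1) * Real.sin (κ * x) / x)]
  · have hx0 := hx.1
    have hs := sin_half_pos hx
    have hxs := div_pi_le_sin_half hx0.le hx.2
    rw [div_le_iff₀' hπ] at hxs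
    have hr := abs_weight_sub_inv_le hx
    set s := Real.sin (x / 2) with hsd
    set D := Real.cos (2 * ω * t * s) - 1 with hD
    have hDb : |D| ≤ 2 := abs_cos_sub_one_le _
    have hDx : |D * (x ^ 2 / (4 * s ^ 2))| ≤ Real.pi ^ 2 / 2 := by
      rw [abs_mul, abs_of_nonneg (a := x ^ 2 / (4 * s ^ 2)) (by positivity)]
      calc |D| * (x ^ 2 / (4 * s ^ 2)) ≤ 2 * ((Real.pi * s) ^ 2 / (4 * s ^ 2)) := by gcongr
        _ = Real.pi ^ 2 / 2 := by field_simp; norm_num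
    set U := u x / x ^ 2 with hU
    set V := (v x - A * x) / x ^ 2 with hV
    have eU : u x = x ^ 2 * U := by rw [hU]; field_simp
    have eV : v x = x ^ 2 * V + A * x := by rw [hV]; field_simp; ring
    have e : posMultiplier ω t x * (u x * Real.cos (κ * x) + v x * Real.sin (κ * x)) -
        A * (D * Real.sin (κ * x) / x) =
        D * (x ^ 2 / (4 * s ^ 2)) * (U * Real.cos (κ * x) + V * Real.sin (κ * x)) +
        A * (D * (x / (4 * s ^ 2) - 1 / x) * Real.sin (κ * x)) := by
      rw [eU, eV, posMultiplier, ← hsd, ← hD]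
      ring
    have hc := Real.abs_cos_le_one (κ * x)
    have hsn := Real.abs_sin_le_one (κ * x)
    rw [e, Real.norm_eq_abs]
    refine (abs_add_le _ _).trans (add_le_add ?_ ?_)
    · rw [abs_mul]
      refine mul_le_mul hDx ((abs_add_le _ _).trans (add_le_add ?_ ?_)) (abs_nonneg _) (by positivity)
      · rw [abs_mul]
        exact mul_le_of_le_one_right (abs_nonneg _) hc
      · rw [abs_mul]
        exact mul_le_of_le_one_right (abs_nonneg _) hsn
    · rw [abs_mul, abs_mul, abs_mul]
      refine mul_le_mul_of_nonneg_left ?_ (abs_nonneg A)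
      exact (mul_le_of_le_one_right (by positivity) hsn).trans
        ((mul_le_mul hDb hr (abs_nonneg _) zero_le_two).trans_eq (by norm_num))

/-! ### Construction of the solution -/

lemma exists_bounded_chain_solution {q₀ : ℤ → ℝ} {B : ℝ} (ω : ℝ) (hB : ∀ k, |q₀ k| ≤ B)
    (hu : IntervalIntegrable (fun x => u x / x ^ 2) MeasureTheory.volume 0 Real.pi)
    (hv : IntervalIntegrable (fun x => (v x - A * x) / x ^ 2) MeasureTheory.volume 0 Real.pi)
    (hq : ∀ k : ℤ, secondDiff q₀ k = Real.pi⁻¹ * ∫ x in (0 : ℝ)..Real.pi,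
      (u x * Real.cos (k * x) + v x * Real.sin (k * x))) :
    ∃ q p : ℝ → ℤ → ℝ, IsChainSolution ω q₀ q p ∧
      ∃ C : ℝ, ∀ t : ℝ, 0 ≤ t → ∀ k : ℤ, |q t k| ≤ C := by
  have hπ := Real.pi_pos
  have hu' : IntervalIntegrable u MeasureTheory.volume 0 Real.pi :=
    intervalIntegrable_of_div_sq (c := fun _ => 0) continuous_const (by simpa using hu)
  have hv' := intervalIntegrable_of_div_sq (by fun_prop) hv
  obtain ⟨C, hC⟩ := abs_integral_posMultiplier_mul_le hu hv
  set w : ℤ → ℝ → ℝ := fun k x => u x * Real.cos (k * x) + v x * Real.sin (k * x) with hw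
  have iw : ∀ k, IntervalIntegrable (w k) MeasureTheory.volume 0 Real.pi :=
    fun k => intervalIntegrable_trig_combination hu' hv' k
  set q : ℝ → ℤ → ℝ := fun t k =>
    q₀ k + Real.pi⁻¹ * ∫ x in (0 : ℝ)..Real.pi, posMultiplier ω t x * w k x with hqd
  set p : ℝ → ℤ → ℝ := fun t k =>
    Real.pi⁻¹ * ∫ x in (0 : ℝ)..Real.pi, velMultiplier ω t x * w k x with hpd
  have iq : ∀ t k, IntervalIntegrable (fun x => posMultiplier ω t x * w k x)
      MeasureTheory.volume 0 Real.pi := fun t k =>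
    intervalIntegrable_bounded_mul (measurable_posMultiplier ω t) (iw k)
      fun x hx => abs_posMultiplier_le ω t hx
  have hbound : ∀ t k, |q t k| ≤ B + Real.pi⁻¹ * C := fun t k => by
    refine (abs_add_le _ _).trans (add_le_add (hB k) ?_)
    rw [abs_mul, abs_of_pos (inv_pos.2 hπ)]
    exact mul_le_mul_of_nonneg_left (hC ω t k) (inv_pos.2 hπ).le
  refine ⟨q, p, ⟨?_, ?_, ?_, ?_, fun T _ => ⟨_, fun t _ k => hbound t k⟩⟩, _, fun t _ k => hbound t k⟩
  · funext k
    simp [hqd, posMultiplier]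
  · funext k
    simp [hpd, velMultiplier]
  · intro t _ k
    -- Domination is needed only for times within distance 1 of `t`, where `|s| ≤ |t| + 1`.
    refine (((hasDerivAt_integral_mul (c' := ω ^ 2 * (|t| + 1)) (iw k)
      (measurable_posMultiplier ω) (measurable_velMultiplier ω t)
      (fun x hx => abs_posMultiplier_le ω t hx) (fun s hs x hx => ?_)
      (fun s x hx => hasDerivAt_posMultiplier ω s hx)).const_mul Real.pi⁻¹).const_add
        (q₀ k)).hasDerivWithinAt
    refine (abs_velMultiplier_le ω s hx).trans ?_
    rw [Metric.mem_ball, Real.dist_eq] at hs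
    have := abs_sub_abs_le_abs_sub s t
    gcongr
    linarith
  · intro t _ k
    refine ((hasDerivAt_integral_mul (c' := ω ^ 2)
      (m' := fun t x => -(ω ^ 2 * Real.cos (2 * ω * t * Real.sin (x / 2)))) (iw k)
      (measurable_velMultiplier ω) (by fun_prop)
      (fun x hx => abs_velMultiplier_le ω t hx) (fun s _ x _ => ?_)
      (fun s x hx => hasDerivAt_velMultiplier ω s hx)).const_mul Real.pi⁻¹).hasDerivWithinAt.congr_deriv ?_
    · rw [abs_neg, abs_mul, abs_of_nonneg (sq_nonneg ω)]
      exact mul_le_of_le_one_right (sq_nonneg ω) (Real.abs_cos_le_one _)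
    have e1 : discreteLaplacian (q t) k = -secondDiff q₀ k + Real.pi⁻¹ *
        ((∫ x in (0 : ℝ)..Real.pi, posMultiplier ω t x * w (k + 1) x) -
          2 * (∫ x in (0 : ℝ)..Real.pi, posMultiplier ω t x * w k x) +
          ∫ x in (0 : ℝ)..Real.pi, posMultiplier ω t x * w (k - 1) x) := by
      simp only [discreteLaplacian, secondDiff, hqd]
      ring
    have hqw : secondDiff q₀ k = Real.pi⁻¹ * ∫ x in (0 : ℝ)..Real.pi, w k x := hq k
    have iwn : IntervalIntegrable (fun x => -w k x) MeasureTheory.volume 0 Real.pi := (iw k).neg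
    rw [e1, hqw, ← intervalIntegral.integral_const_mul 2,
      ← intervalIntegral.integral_sub (iq _ _) ((iq _ _).const_mul 2),
      ← intervalIntegral.integral_add ((iq _ _).sub ((iq _ _).const_mul 2)) (iq _ _),
      ← mul_neg, ← intervalIntegral.integral_neg, ← mul_add,
      ← intervalIntegral.integral_add iwn
        (((iq _ _).sub ((iq _ _).const_mul 2)).add (iq _ _)), mul_left_comm,
      ← intervalIntegral.integral_const_mul (ω ^ 2)]
    congr 1
    refine intervalIntegral.integral_congr_ae (Filter.Eventually.of_forall fun x hx => ?_)
    rw [Set.uIoc_of_le hπ.le] at hx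
    have hs := (sin_half_pos hx).ne'
    have hcos : Real.cos x = 1 - 2 * Real.sin (x / 2) ^ 2 := by
      have := Real.cos_two_mul (x / 2)
      rw [mul_div_cancel₀ x two_ne_zero] at this
      linarith [Real.sin_sq_add_cos_sq (x / 2)]
    -- The Laplacian in `k` acts on `w` as `-4 sin² (x / 2)`, which cancels the denominator of the
    -- multiplier. The `-1` in its numerator is then compensated by `-secondDiff q₀ k`, leaving only
    -- the cosine.
    have hlap : w (k + 1) x - 2 * w k x + w (k - 1) x = -(4 * Real.sin (x / 2) ^ 2) * w k x := by
      simp only [hw]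
      push_cast
      rw [add_mul, sub_mul, one_mul, Real.cos_add, Real.cos_sub, Real.sin_add, Real.sin_sub, hcos]
      ring
    have e2 : posMultiplier ω t x * w (k + 1) x - 2 * (posMultiplier ω t x * w k x) +
        posMultiplier ω t x * w (k - 1) x =
        -(Real.cos (2 * ω * t * Real.sin (x / 2)) - 1) * w k x := by
      calc _ = posMultiplier ω t x * (w (k + 1) x - 2 * w k x + w (k - 1) x) := by ring
        _ = _ := by
          rw [hlap, posMultiplier]
          field_simp
    rw [e2]
    ring

end

/-! ### Fourier inversion for real sequences on half the circle -/

lemma fourierCoeff_fourierTransformL2 (a : lp (fun _ : ℤ => ℂ) 2) (k : ℤ) :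
    fourierCoeff (fourierTransformL2 a) k = a k := by
  rw [← fourierBasis_repr, fourierTransformL2, LinearIsometryEquiv.apply_symm_apply]

lemma fourier_apply_neg {T : ℝ} (n : ℤ) (y : AddCircle T) :
    fourier n (-y) = fourier (-n) y := by
  rw [fourier_apply, fourier_apply, smul_neg, neg_smul]

/-- For real coefficients, `y ↦ conj (f (-y))` has the same Fourier coefficients as `f`, hence is
the same element of `L²`. -/
lemma fourierTransformL2_neg_ae {a : lp (fun _ : ℤ => ℂ) 2}
    (ha : ∀ k, (starRingEnd ℂ) (a k) = a k) :
    ∀ᵐ y ∂(AddCircle.haarAddCircle (T := 2 * Real.pi)),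
      fourierTransformL2 a (-y) = (starRingEnd ℂ) (fourierTransformL2 a y) := by
  set f := fourierTransformL2 a with hf
  have hmem : MeasureTheory.MemLp (star (f ∘ Neg.neg)) 2
      (AddCircle.haarAddCircle (T := 2 * Real.pi)) :=
    ((MeasureTheory.Lp.memLp f).comp_measurePreserving
      (MeasureTheory.Measure.measurePreserving_neg _)).star
  have hcoeff : ∀ k, fourierCoeff (star (f ∘ Neg.neg)) k = a k := fun k => by
    rw [← ha k, ← fourierCoeff_fourierTransformL2 a k, ← hf]
    simp only [fourierCoeff]
    rw [← integral_conj, ← MeasureTheory.integral_neg_eq_self]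
    refine MeasureTheory.integral_congr_ae (Filter.Eventually.of_forall fun y => ?_)
    simp only [Pi.star_apply, Function.comp_apply, neg_neg, smul_eq_mul, map_mul, RCLike.star_def]
    congr 1
    rw [fourier_apply_neg, ← fourier_neg, neg_neg]
  have heq : hmem.toLp _ = f := by
    apply (fourierBasis (T := 2 * Real.pi)).repr.injective
    ext k
    rw [fourierBasis_repr, fourierBasis_repr, fourierCoeff_fourierTransformL2,
      fourierCoeff_congr_ae hmem.coeFn_toLp, hcoeff]
  have h1 := hmem.coeFn_toLp
  rw [heq] at h1
  filter_upwards [h1] with y hy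
  rw [hy]
  simp

lemma ae_volume_of_ae_haarAddCircle {P : AddCircle (2 * Real.pi) → Prop}
    (h : ∀ᵐ y ∂(AddCircle.haarAddCircle (T := 2 * Real.pi)), P y) :
    ∀ᵐ x : ℝ ∂MeasureTheory.volume, x ∈ Set.Ioc 0 Real.pi → P x := by
  have h1 : ∀ᵐ y : AddCircle (2 * Real.pi) ∂MeasureTheory.volume, P y := by
    rw [AddCircle.volume_eq_smul_haarAddCircle]
    exact MeasureTheory.Measure.ae_smul_measure h _
  have h2 := (AddCircle.measurePreserving_mk (2 * Real.pi) 0).quasiMeasurePreserving.ae h1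
  rw [MeasureTheory.ae_restrict_iff' measurableSet_Ioc] at h2
  filter_upwards [h2] with x hx hx'
  exact hx ⟨hx'.1, by linarith [hx'.2, Real.pi_pos]⟩

lemma intervalIntegrable_Lp_haarAddCircle
    (f : MeasureTheory.Lp ℂ 2 (AddCircle.haarAddCircle (T := 2 * Real.pi))) :
    IntervalIntegrable (fun x : ℝ => f (x : AddCircle (2 * Real.pi))) MeasureTheory.volume
      (-Real.pi) Real.pi := by
  have h1 : MeasureTheory.Integrable f (AddCircle.haarAddCircle (T := 2 * Real.pi)) :=
    (MeasureTheory.Lp.memLp f).integrable one_le_two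
  have h2 : MeasureTheory.Integrable f
      (MeasureTheory.volume : MeasureTheory.Measure (AddCircle (2 * Real.pi))) := by
    rw [AddCircle.volume_eq_smul_haarAddCircle]
    exact h1.smul_measure ENNReal.ofReal_ne_top
  have h3 := (AddCircle.measurePreserving_mk (2 * Real.pi) (-Real.pi)).integrable_comp_of_integrable h2
  rw [intervalIntegrable_iff_integrableOn_Ioc_of_le (by linarith [Real.pi_pos])]
  rwa [show -Real.pi + 2 * Real.pi = Real.pi by ring] at h3

lemma fourier_coe_two_pi (k : ℤ) (x : ℝ) :
    fourier k (x : AddCircle (2 * Real.pi)) = Complex.exp ((k * x : ℝ) * Complex.I) := by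
  rw [fourier_coe_apply]
  congr 1
  have := Real.pi_ne_zero
  push_cast
  field_simp

/-- A square-summable real sequence is recovered from its Fourier transform on `[0, π]` alone. -/
lemma re_eq_integral_fourierTransformL2 {a : lp (fun _ : ℤ => ℂ) 2}
    (ha : ∀ k, (starRingEnd ℂ) (a k) = a k) (k : ℤ) :
    (a k).re = Real.pi⁻¹ * ∫ x in (0 : ℝ)..Real.pi,
      ((fourierTransformL2 a (x : AddCircle (2 * Real.pi))).re * Real.cos (k * x) +
        (fourierTransformL2 a (x : AddCircle (2 * Real.pi))).im * Real.sin (k * x)) := by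
  have hπ := Real.pi_pos
  set f := fourierTransformL2 a with hf
  set g : ℝ → ℂ := fun x => fourier (-k) (x : AddCircle (2 * Real.pi)) • f (x : AddCircle (2 * Real.pi))
    with hg
  have ig : IntervalIntegrable g MeasureTheory.volume (-Real.pi) Real.pi := by
    refine (intervalIntegrable_Lp_haarAddCircle f).continuousOn_mul (Continuous.continuousOn ?_)
    simp_rw [fourier_coe_two_pi]
    fun_prop
  have i1 : IntervalIntegrable g MeasureTheory.volume (-Real.pi) 0 := ig.mono_set <| by
    rw [Set.uIcc_of_le (by linarith), Set.uIcc_of_le (by linarith)]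
    exact Set.Icc_subset_Icc_right hπ.le
  have i2 : IntervalIntegrable g MeasureTheory.volume 0 Real.pi := ig.mono_set <| by
    rw [Set.uIcc_of_le (by linarith), Set.uIcc_of_le (by linarith)]
    exact Set.Icc_subset_Icc_left (by linarith)
  -- By this symmetry the two halves of the inversion integral are conjugate, so their sum is twice
  -- the real part of the half over `[0, π]`; this turns `1 / (2π)` into `1 / π`.
  have hneg : ∫ x in (-Real.pi)..0, g x = (starRingEnd ℂ) (∫ x in (0 : ℝ)..Real.pi, g x) := by
    have := intervalIntegral.integral_comp_neg (a := 0) (b := Real.pi) g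
    rw [neg_zero] at this
    rw [← this, intervalIntegral.integral_of_le hπ.le, intervalIntegral.integral_of_le hπ.le,
      ← integral_conj]
    refine MeasureTheory.integral_congr_ae ((MeasureTheory.ae_restrict_iff' measurableSet_Ioc).2 ?_)
    filter_upwards [ae_volume_of_ae_haarAddCircle (fourierTransformL2_neg_ae ha)] with x hx hx'
    simp only [hg, smul_eq_mul, map_mul]
    rw [AddCircle.coe_neg, hx hx', fourier_apply_neg, ← fourier_neg]
  have hc := fourierCoeff_eq_intervalIntegral f k (-Real.pi)
  rw [fourierCoeff_fourierTransformL2, show -Real.pi + 2 * Real.pi = Real.pi by ring,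
    ← intervalIntegral.integral_add_adjacent_intervals i1 i2, hneg] at hc
  have hre : (∫ x in (0 : ℝ)..Real.pi, g x).re = ∫ x in (0 : ℝ)..Real.pi, (g x).re := by
    rw [intervalIntegral.integral_of_le hπ.le, intervalIntegral.integral_of_le hπ.le]
    exact (integral_re i2.1).symm
  have hgre : ∀ x, (g x).re = (f (x : AddCircle (2 * Real.pi))).re * Real.cos (k * x) +
      (f (x : AddCircle (2 * Real.pi))).im * Real.sin (k * x) := fun x => by
    simp only [hg, smul_eq_mul]
    rw [fourier_coe_two_pi, Complex.mul_re, Complex.exp_ofReal_mul_I_re,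
      Complex.exp_ofReal_mul_I_im]
    push_cast
    rw [neg_mul, Real.cos_neg, Real.sin_neg]
    ring
  simp_rw [← hgre]
  rw [hc, ← hre]
  simp only [Complex.real_smul, Complex.re_ofReal_mul, Complex.add_re, Complex.conj_re]
  field_simp
  ring

/-! ### The main theorem -/

theorem theorem1 (ω : ℝ) (hω : 0 < ω) (q₀ : ℤ → ℝ) (hq₀ : q₀ ∈ lDelta) :
    ∃ q p : ℝ → ℤ → ℝ,
      IsChainSolution ω q₀ q p ∧
      (∀ q' p' : ℝ → ℤ → ℝ, IsChainSolution ω q₀ q' p' → ∀ t : ℝ, 0 ≤ t → q' t = q t) ∧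
      ∃ C : ℝ, ∀ t : ℝ, 0 ≤ t → ∀ k : ℤ, |q t k| ≤ C := by
  obtain ⟨hbdd, hq, A, hA⟩ := hq₀
  obtain ⟨B, hB⟩ := memℓp_infty_iff.1 hbdd
  set a : lp (fun _ : ℤ => ℂ) 2 := ⟨fun k : ℤ => (secondDiff q₀ k : ℂ), hq⟩ with had
  set f := fourierTransformL2 a with hf
  have hh : ∀ x ∈ Set.Ioc 0 Real.pi,
      (1 / (x : ℂ)) * (f (x : AddCircle (2 * Real.pi)) / (x : ℂ) - Complex.I * (A : ℂ)) =
      ((x⁻¹ : ℝ) : ℂ) * (((x⁻¹ : ℝ) : ℂ) * f (x : AddCircle (2 * Real.pi)) -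
        (A : ℂ) * Complex.I) := fun x _ => by
    push_cast
    ring
  have hA' := (hA.mono_set Set.Ioc_subset_Icc_self).congr_fun hh measurableSet_Ioc
  -- Because `A` is real, the counterterm `i A` affects only the imaginary part: the real part of
  -- `h` is `u / x²`, and the imaginary part is `(v - A x) / x²`.
  have hu : IntervalIntegrable (fun x : ℝ => (f (x : AddCircle (2 * Real.pi))).re / x ^ 2)
      MeasureTheory.volume 0 Real.pi := by
    rw [intervalIntegrable_iff_integrableOn_Ioc_of_le Real.pi_pos.le]
    refine MeasureTheory.IntegrableOn.congr_fun hA'.re (fun x hx => ?_) measurableSet_Ioc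
    have := hx.1.ne'
    simp only [RCLike.re_eq_complex_re, Complex.re_ofReal_mul, Complex.sub_re, Complex.I_re]
    field_simp
    ring
  have hv : IntervalIntegrable
      (fun x : ℝ => ((f (x : AddCircle (2 * Real.pi))).im - A * x) / x ^ 2)
      MeasureTheory.volume 0 Real.pi := by
    rw [intervalIntegrable_iff_integrableOn_Ioc_of_le Real.pi_pos.le]
    refine MeasureTheory.IntegrableOn.congr_fun hA'.im (fun x hx => ?_) measurableSet_Ioc
    have := hx.1.ne'
    simp only [RCLike.im_eq_complex_im, Complex.im_ofReal_mul, Complex.sub_im, Complex.I_im]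
    field_simp
  obtain ⟨q, p, hsol, hC⟩ := exists_bounded_chain_solution ω
    (fun k => hB (Set.mem_range_self k)) hu hv fun k => by
      have := re_eq_integral_fourierTransformL2 (a := a) (fun k => Complex.conj_ofReal _) k
      rwa [show (a k).re = secondDiff q₀ k from Complex.ofReal_re _] at this
  exact ⟨q, p, hsol, fun q' p' h' t ht => hsol.unique h' ht, hC⟩
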